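/- A rooted plane tree consists of a root and a (possibly empty) ordered list of branches, each of which is again a rooted plane tree; its size is its number of vertices, and a leaf is a vertex without children. The protection number of a vertex $v$ is the minimum distance of $v$ from a leaf in the maximal subtree rooted at $v$ (so a leaf has protection number $0$), and $v$ is $k$-protected if its protection number is at least $k$. For $n \ge 1$ let $Y_n$ be the protection number of a uniformly chosen vertex of a uniformly chosen random rooted plane tree with $n$ vertices. **Proposition.** The probability that a random vertex of a random tree with $n$ vertices is $k$-protected is $$\mathbb{P}(Y_n \ge k) = \frac{3}{4^k+2} + \frac{(3k-10)4^{2k} + (6k+26)4^k - 16}{2(4^k+2)^3}\cdot\frac{1}{n} + O\Bigl(\frac{k^2}{3^k n^2}\Bigr),$$ where the implied constant is absolute, i.e. the estimate holds uniformly for all integers $n \ge 1$ and $k \ge 0$. -/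

import Mathlib

/-- Rooted plane trees: a root together with the ordered list of its branches. -/
inductive PlaneTree : Type
  | node (children : List PlaneTree) : PlaneTree

namespace PlaneTree

/-- The maximal (fringe) subtrees of `t` in preorder, one entry for each vertex of `t`: the entry
of a vertex `v` is the subtree that consists of `v` and all its descendants. Equal subtrees
rooted at different vertices are listed separately. -/
def subtrees : PlaneTree → List PlaneTree
  | node cs => node cs :: cs.flatMap subtrees

/-- The size of a tree: its number of vertices. -/
def size (t : PlaneTree) : ℕ := t.subtrees.length

/-- `LeafAtDist t d`: some leaf (vertex without children) of `t` has distance `d` from the root. -/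
inductive LeafAtDist : PlaneTree → ℕ → Prop
  | leaf : LeafAtDist (node []) 0
  | child (cs : List PlaneTree) (c : PlaneTree) (d : ℕ) (hc : c ∈ cs) (h : LeafAtDist c d) :
      LeafAtDist (node cs) (d + 1)

/-- The protection number of (the root of) a tree: the minimum distance of the root from a leaf. -/
noncomputable def protection (t : PlaneTree) : ℕ := sInf {d : ℕ | LeafAtDist t d}

theorem size_node (cs : List PlaneTree) : size (node cs) = 1 + (cs.map size).sum := by
  unfold size
  rw [subtrees, List.length_cons, List.length_flatMap, add_comm]

theorem finite_forests (m : ℕ) : {cs : List PlaneTree | (cs.map size).sum = m}.Finite := by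
  induction m using Nat.strong_induction_on with
  | _ m ih =>
    have hfin : (⋃ i : Fin m, ⋃ j : Fin m,
        Set.image2 (fun cs rest => node cs :: rest)
          {cs : List PlaneTree | (cs.map size).sum = i}
          {cs : List PlaneTree | (cs.map size).sum = j}).Finite :=
      Set.finite_iUnion fun i => Set.finite_iUnion fun j =>
        Set.Finite.image2 _ (ih i i.2) (ih j j.2)
    refine (hfin.insert []).subset ?_
    rintro (_ | ⟨⟨cs⟩, rest⟩) h
    · exact Set.mem_insert _ _
    · right
      simp only [Set.mem_ofPred_eq, List.map_cons, List.sum_cons, size_node] at h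
      simp only [Set.mem_iUnion]
      have h1 : (cs.map size).sum < m := by omega
      have h2 : (rest.map size).sum < m := by omega
      exact ⟨⟨_, h1⟩, ⟨_, h2⟩, Set.mem_image2_of_mem rfl rfl⟩

theorem finite_size (n : ℕ) : {t : PlaneTree | t.size = n}.Finite := by
  refine ((finite_forests (n - 1)).image node).subset ?_
  rintro ⟨cs⟩ h
  refine ⟨cs, ?_, rfl⟩
  simp only [Set.mem_ofPred_eq, size_node] at h ⊢
  omega

/-- The finite set of all rooted plane trees with `n` vertices. -/
noncomputable def treesOfSize (n : ℕ) : Finset PlaneTree := (finite_size n).toFinset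

theorem treesOfSize_nonempty (n : ℕ) (hn : 0 < n) : (treesOfSize n).Nonempty := by
  refine ⟨node (List.replicate (n - 1) (node [])), ?_⟩
  simp only [treesOfSize, Set.Finite.mem_toFinset, Set.mem_ofPred_eq, size_node,
    List.map_replicate, List.sum_replicate, List.map_nil, List.sum_nil, smul_eq_mul]
  omega

theorem coe_subtrees_ne_zero (t : PlaneTree) : (t.subtrees : Multiset PlaneTree) ≠ 0 := by
  cases t with
  | node cs => simp [subtrees]

/-- A uniformly chosen random tree with `n ≥ 1` vertices. -/
noncomputable def randomTree (n : ℕ) (hn : 0 < n) : PMF PlaneTree :=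
  PMF.uniformOfFinset (treesOfSize n) (treesOfSize_nonempty n hn)

/-- The maximal subtree rooted at a uniformly chosen random vertex of `t`. -/
noncomputable def randomSubtree (t : PlaneTree) : PMF PlaneTree :=
  PMF.ofMultiset (t.subtrees : Multiset PlaneTree) t.coe_subtrees_ne_zero

/-- The law of `Y_n`, the protection number of a uniformly chosen vertex of a uniformly chosen
random tree with `n` vertices. -/
noncomputable def vertexProtectionLaw (n : ℕ) (hn : 0 < n) : PMF ℕ :=
  ((randomTree n hn).bind randomSubtree).map protection

end PlaneTree

/-!
Let `F = 1 + X * F ^ 2` be the generating function of forests, and `B = F / (1 - X * F ^ 2)` that of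
the central binomial coefficients. The recursion for `k`-protected roots is solved by
`X ^ (k + 1) * F ^ 3 * (1 - X) / (1 + X ^ (k + 1) * F ^ 3)`, and marking a vertex multiplies this by
`B / F`. Expanding the resulting quotient
`X ^ (k + 1) * (1 + X * F ^ 3) * B / (1 + X ^ (k + 1) * F ^ 3)` as a geometric series, where
`F ^ m * B` has the coefficients `(2 * l + m).choose l`, gives the number of `k`-protected vertices
as an alternating sum of binomial coefficients. After division by the central binomial coefficient,
which counts all vertices, the `j`-th summand is `(-2) ^ j * 4 ^ (-k * (j + 1))` times a quantity
that agrees with its first-order expansion in `1 / n` up to `O(s ^ 6 / n ^ 2)`, `s = k * (j + 1)`,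
uniformly: by Stirling-type estimates if `s ^ 2` is small against `n`, trivially otherwise. Summing
the expansions gives the main terms, and the errors add up to `O(k ^ 6 / (4 ^ k * n ^ 2))`.
-/

section CentralBinomial

open PowerSeries

variable {R : Type*} [CommRing R] {F : R⟦X⟧}

/-- The generating function of the central binomial coefficients. -/
noncomputable def centralBinomSeries (R : Type*) [CommRing R] : R⟦X⟧ :=
  PowerSeries.mk fun n => (n.centralBinom : R)

lemma constantCoeff_eq_one_of_eq_one_add_X_mul_sq (hF : F = 1 + X * F ^ 2) :
    constantCoeff F = 1 := by
  rw [hF]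
  simp

lemma coeff_pow_mul_centralBinomSeries (hF : F = 1 + X * F ^ 2) (l m : ℕ) :
    coeff l (F ^ m * centralBinomSeries R) = ((2 * l + m).choose l : R) := by
  induction l generalizing m with
  | zero => simp [centralBinomSeries, constantCoeff_eq_one_of_eq_one_add_X_mul_sq hF]
  | succ l ihl =>
    induction m with
    | zero => simp [centralBinomSeries, Nat.centralBinom]
    | succ m ihm =>
      have hrec : F ^ (m + 1) * centralBinomSeries R =
          F ^ m * centralBinomSeries R + X * (F ^ (m + 2) * centralBinomSeries R) := by
        linear_combination F ^ m * centralBinomSeries R * hF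
      rw [hrec, map_add, coeff_succ_X_mul, ihl, ihm, ← add_assoc (2 * (l + 1)),
        Nat.choose_succ_succ', show 2 * (l + 1) + m = 2 * l + (m + 2) by ring]
      push_cast
      ring

lemma centralBinom_succ_eq_two_mul_choose (l : ℕ) :
    (l + 1).centralBinom = 2 * (2 * l + 1).choose l := by
  rw [Nat.centralBinom_eq_two_mul_choose, show 2 * (l + 1) = 2 * l + 1 + 1 by ring,
    Nat.choose_succ_succ', Nat.choose_symm_half]
  ring

lemma centralBinomSeries_mul_one_sub (hF : F = 1 + X * F ^ 2) :
    centralBinomSeries R * (1 - X * F ^ 2) = F := by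
  have hB : centralBinomSeries R = 1 + X * (2 * (F ^ 1 * centralBinomSeries R)) := by
    ext n
    cases n with
    | zero => simp [centralBinomSeries]
    | succ l =>
      rw [map_add, coeff_succ_X_mul, two_mul, map_add, coeff_pow_mul_centralBinomSeries hF,
        coeff_one, if_neg l.succ_ne_zero, centralBinomSeries, coeff_mk,
        centralBinom_succ_eq_two_mul_choose]
      push_cast
      ring
  linear_combination F * hB - centralBinomSeries R * hF

end CentralBinomial

namespace PlaneTree

section GeneratingFunctions

open PowerSeries Finset

/-- The finite set of all forests (ordered lists of trees) with `m` vertices in total. -/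
noncomputable def forestsOfSize (m : ℕ) : Finset (List PlaneTree) := (finite_forests m).toFinset

lemma mem_treesOfSize {n : ℕ} {t : PlaneTree} : t ∈ treesOfSize n ↔ t.size = n := by
  simp [treesOfSize]

lemma mem_forestsOfSize {m : ℕ} {cs : List PlaneTree} :
    cs ∈ forestsOfSize m ↔ (cs.map size).sum = m := by
  simp [forestsOfSize]

lemma sum_forestsOfSize {M : Type*} [AddCommMonoid M] (g : List PlaneTree → M) (m : ℕ) :
    ∑ cs ∈ forestsOfSize m, g cs = (if m = 0 then g [] else 0) +
      ∑ p ∈ antidiagonal m, ∑ t ∈ treesOfSize p.1, ∑ r ∈ forestsOfSize p.2, g (t :: r) := by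
  classical
  rw [← sum_filter_add_sum_filter_not _ (· = [])]
  congr 1
  · simp [sum_filter, mem_forestsOfSize, eq_comm]
  · simp only [← sum_product', sum_sigma']
    refine (sum_nbij (fun x : Σ _ : ℕ × ℕ, PlaneTree × List PlaneTree => x.2.1 :: x.2.2)
      ?_ ?_ ?_ fun _ _ => rfl).symm
    · rintro ⟨p, t, r⟩ h
      simp only [mem_sigma, HasAntidiagonal.mem_antidiagonal, mem_product, mem_treesOfSize,
        mem_forestsOfSize] at h
      simp [mem_forestsOfSize, h]
    · rintro ⟨⟨i, j⟩, t, r⟩ h ⟨⟨i', j'⟩, t', r'⟩ h' hcons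
      simp_all [mem_treesOfSize, mem_forestsOfSize]
    · rintro (_ | ⟨t, r⟩) h
      · simp at h
      · exact ⟨⟨(t.size, (r.map size).sum), t, r⟩,
          by simpa [mem_treesOfSize, mem_forestsOfSize] using h, rfl⟩

variable {R : Type*}

/-- The generating function of trees by size, each tree `t` weighted by `f t`. -/
noncomputable def treeSeries [Semiring R] (f : PlaneTree → R) : R⟦X⟧ :=
  PowerSeries.mk fun n => ∑ t ∈ treesOfSize n, f t

/-- The generating function of forests by size, each forest `cs` weighted by `g cs`. -/
noncomputable def forestSeries [Semiring R] (g : List PlaneTree → R) : R⟦X⟧ :=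
  PowerSeries.mk fun n => ∑ cs ∈ forestsOfSize n, g cs

lemma treeSeries_eq_X_mul [Semiring R] (f : PlaneTree → R) :
    treeSeries f = X * forestSeries fun cs => f (node cs) := by
  ext n
  cases n with
  | zero =>
    rw [treeSeries, coeff_mk, coeff_zero_X_mul]
    refine sum_eq_zero ?_
    rintro ⟨cs⟩ h
    rw [mem_treesOfSize, size_node] at h
    omega
  | succ n =>
    rw [coeff_succ_X_mul, treeSeries, forestSeries, coeff_mk, coeff_mk]
    refine (sum_nbij node ?_ ?_ ?_ fun _ _ => rfl).symm
    · intro cs h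
      rw [mem_treesOfSize, size_node, mem_forestsOfSize.1 h, add_comm]
    · exact fun _ _ _ _ h => node.inj h
    · rintro ⟨cs⟩ h
      rw [mem_coe, mem_treesOfSize, size_node] at h
      exact ⟨cs, mem_forestsOfSize.2 (by omega), rfl⟩

lemma forestSeries_add [Semiring R] (f g : List PlaneTree → R) :
    forestSeries (fun cs => f cs + g cs) = forestSeries f + forestSeries g := by
  ext m
  simp [forestSeries, sum_add_distrib]

lemma forestSeries_indicator_nil [Semiring R] :
    forestSeries (fun cs => if cs = [] then (1 : R) else 0) = 1 := by
  ext m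
  rw [forestSeries, coeff_mk, sum_forestsOfSize, coeff_one]
  simp

lemma forestSeries_prod [CommSemiring R] (f : PlaneTree → R) :
    forestSeries (fun cs => (cs.map f).prod) =
      1 + treeSeries f * forestSeries (fun cs => (cs.map f).prod) := by
  ext m
  simp [forestSeries, treeSeries, sum_forestsOfSize _ m, coeff_mul, coeff_one, sum_mul_sum]

lemma forestSeries_sum [Semiring R] (f : PlaneTree → R) :
    forestSeries (fun cs => (cs.map f).sum) =
      treeSeries f * forestSeries (fun _ => 1) +
        treeSeries (fun _ => 1) * forestSeries (fun cs => (cs.map f).sum) := by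
  ext m
  rw [forestSeries, coeff_mk, sum_forestsOfSize]
  simp only [forestSeries, treeSeries, map_add, coeff_mul, coeff_mk, List.map_nil, List.sum_nil,
    ite_self, zero_add, List.map_cons, List.sum_cons, sum_mul_sum, one_mul, mul_one,
    sum_add_distrib]

variable (R)

/-- The generating function of all forests. -/
noncomputable def allForests [Semiring R] : R⟦X⟧ := forestSeries fun _ => 1

lemma treeSeries_one [Semiring R] : treeSeries (fun _ => (1 : R)) = X * allForests R :=
  treeSeries_eq_X_mul _

lemma allForests_eq [CommRing R] : allForests R = 1 + X * allForests R ^ 2 := by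
  have h := forestSeries_prod fun _ => (1 : R)
  simp only [List.map_const', List.prod_replicate, one_pow, treeSeries_one] at h
  rwa [← allForests, mul_assoc, ← sq] at h

end GeneratingFunctions

section Protection

lemma exists_leafAtDist : ∀ t : PlaneTree, ∃ d, LeafAtDist t d
  | node [] => ⟨0, .leaf⟩
  | node (c :: cs) => by
    obtain ⟨d, hd⟩ := exists_leafAtDist c
    exact ⟨d + 1, .child _ c d List.mem_cons_self hd⟩

lemma le_protection_iff {t : PlaneTree} {k : ℕ} :
    k ≤ t.protection ↔ ∀ d, LeafAtDist t d → k ≤ d :=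
  ⟨fun h _ hd => h.trans (Nat.sInf_le hd), le_csInf (exists_leafAtDist t)⟩

lemma succ_le_protection_node_iff {cs : List PlaneTree} {k : ℕ} :
    k + 1 ≤ (node cs).protection ↔ cs ≠ [] ∧ ∀ c ∈ cs, k ≤ c.protection := by
  simp only [le_protection_iff]
  constructor
  · intro h
    refine ⟨?_, fun c hc d hd => Nat.le_of_succ_le_succ (h (d + 1) (.child _ c d hc hd))⟩
    rintro rfl
    exact absurd (h 0 .leaf) (by simp)
  · rintro ⟨hne, h⟩ d hd
    cases hd with
    | leaf => exact absurd rfl hne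
    | child _ c d hc hd => exact Nat.succ_le_succ (h c hc d hd)

/-- The indicator of trees whose root is `k`-protected. -/
noncomputable def protectedIndicator (R : Type*) [Semiring R] (k : ℕ) (t : PlaneTree) : R :=
  if k ≤ t.protection then 1 else 0

/-- The number of `k`-protected vertices of a tree. -/
noncomputable def protectedCount (k : ℕ) (t : PlaneTree) : ℕ :=
  t.subtrees.countP (k ≤ ·.protection)

variable {R : Type*}

lemma protectedIndicator_zero [Semiring R] : protectedIndicator R 0 = fun _ => 1 := by
  funext t
  simp [protectedIndicator]

lemma prod_map_protectedIndicator [CommSemiring R] (k : ℕ) (cs : List PlaneTree) :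
    (cs.map (protectedIndicator R k)).prod = if ∀ c ∈ cs, k ≤ c.protection then 1 else 0 := by
  induction cs with
  | nil => simp
  | cons c cs ih =>
    rw [List.map_cons, List.prod_cons, ih, protectedIndicator]
    by_cases hc : k ≤ c.protection <;> simp [hc]

lemma protectedIndicator_succ_node_add [CommSemiring R] (k : ℕ) (cs : List PlaneTree) :
    protectedIndicator R (k + 1) (node cs) + (if cs = [] then 1 else 0) =
      (cs.map (protectedIndicator R k)).prod := by
  rw [prod_map_protectedIndicator, protectedIndicator]
  simp only [succ_le_protection_node_iff]
  by_cases h : cs = [] <;> simp [h]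

lemma protectedCount_zero (t : PlaneTree) : protectedCount 0 t = t.size := by
  simp [protectedCount, size]

lemma cast_protectedCount_node [Semiring R] (k : ℕ) (cs : List PlaneTree) :
    (protectedCount k (node cs) : R) =
      protectedIndicator R k (node cs) + (cs.map fun c => (protectedCount k c : R)).sum := by
  have hcount : protectedCount k (node cs) =
      (cs.map (protectedCount k)).sum + if k ≤ (node cs).protection then 1 else 0 := by
    rw [protectedCount, subtrees, List.countP_cons, List.countP_flatMap]
    simp only [decide_eq_true_eq]
    rfl
  rw [hcount, add_comm, protectedIndicator]
  push_cast
  simp [Function.comp_def]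

end Protection

section ProtectedSeries

open PowerSeries Finset

variable (R : Type*) [CommRing R]

/-- The generating function of trees whose root is `k`-protected. -/
noncomputable def protectedSeries (k : ℕ) : R⟦X⟧ := treeSeries (protectedIndicator R k)

/-- The generating function of trees with a distinguished `k`-protected vertex. -/
noncomputable def protectedVertexSeries (k : ℕ) : R⟦X⟧ :=
  treeSeries fun t => (protectedCount k t : R)

lemma protectedSeries_zero : protectedSeries R 0 = X * allForests R := by
  rw [protectedSeries, protectedIndicator_zero, treeSeries_one]

lemma protectedSeries_succ_mul_one_sub (k : ℕ) :
    protectedSeries R (k + 1) * (1 - protectedSeries R k) = X * protectedSeries R k := by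
  have hprod := forestSeries_prod (protectedIndicator R k)
  simp only [← protectedIndicator_succ_node_add] at hprod
  rw [forestSeries_add, forestSeries_indicator_nil] at hprod
  have hsucc : protectedSeries R (k + 1) =
      X * forestSeries fun cs => protectedIndicator R (k + 1) (node cs) := treeSeries_eq_X_mul _
  rw [hsucc, protectedSeries]
  linear_combination X * hprod

lemma isUnit_allForests : IsUnit (allForests R) := by
  rw [isUnit_iff_constantCoeff, constantCoeff_eq_one_of_eq_one_add_X_mul_sq (allForests_eq R)]
  exact isUnit_one

lemma protectedSeries_mul (k : ℕ) :
    protectedSeries R k * (1 + X ^ (k + 1) * allForests R ^ 3) =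
      X ^ (k + 1) * allForests R ^ 3 * (1 - X) := by
  induction k with
  | zero =>
    rw [protectedSeries_zero]
    linear_combination (-X * allForests R * (1 + allForests R)) * allForests_eq R
  | succ k ih =>
    set w := X ^ (k + 1) * allForests R ^ 3 with hw
    have hw' : X ^ (k + 1 + 1) * allForests R ^ 3 = X * w := by
      rw [hw]
      ring
    have hcompl : (1 - protectedSeries R k) * (1 + w) = 1 + X * w := by linear_combination -ih
    rw [hw']
    linear_combination (1 + w) * protectedSeries_succ_mul_one_sub R k + X * ih
      - protectedSeries R (k + 1) * hcompl

/-- Removing the subtree of the marked vertex leaves a tree with a marked leaf, and these are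
counted by the quotient of `centralBinomSeries` by `allForests`. -/
lemma protectedVertexSeries_mul_allForests (k : ℕ) :
    protectedVertexSeries R k * allForests R = protectedSeries R k * centralBinomSeries R := by
  set V := protectedVertexSeries R k with hV
  set S : R⟦X⟧ := forestSeries fun cs => (cs.map fun c => (protectedCount k c : R)).sum
  have htree : V = protectedSeries R k + X * S := by
    rw [hV, protectedVertexSeries, treeSeries_eq_X_mul]
    simp only [cast_protectedCount_node]
    rw [forestSeries_add, mul_add, ← treeSeries_eq_X_mul, protectedSeries]
  have hforest : S = V * allForests R + X * allForests R * S := by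
    rw [← treeSeries_one]
    exact forestSeries_sum _
  have hF := allForests_eq R
  have hSV : S = V * allForests R ^ 2 := by
    linear_combination allForests R * hforest - S * hF
  rw [← centralBinomSeries_mul_one_sub hF]
  linear_combination centralBinomSeries R * (htree + X * hSV)

lemma protectedVertexSeries_mul (k : ℕ) :
    protectedVertexSeries R k * (1 + X ^ (k + 1) * allForests R ^ 3) =
      X ^ (k + 1) * ((1 + X * allForests R ^ 3) * centralBinomSeries R) := by
  refine (isUnit_allForests R).mul_left_cancel ?_
  linear_combination (1 + X ^ (k + 1) * allForests R ^ 3) * protectedVertexSeries_mul_allForests R k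
    + centralBinomSeries R * protectedSeries_mul R k
    + X ^ (k + 1) * allForests R * centralBinomSeries R * (1 + allForests R) * allForests_eq R

lemma protectedVertexSeries_zero : protectedVertexSeries R 0 = X * centralBinomSeries R := by
  refine (isUnit_allForests R).mul_left_cancel ?_
  linear_combination protectedVertexSeries_mul_allForests R 0
    + centralBinomSeries R * protectedSeries_zero R

lemma coeff_succ_protectedVertexSeries_zero (n : ℕ) :
    coeff (n + 1) (protectedVertexSeries R 0) = (n.centralBinom : R) := by
  rw [protectedVertexSeries_zero, coeff_succ_X_mul, centralBinomSeries, coeff_mk]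

lemma protectedVertexSeries_eq_sum_add (k m : ℕ) :
    protectedVertexSeries R k =
      ∑ j ∈ range m, (-1) ^ j * (X ^ ((k + 1) * (j + 1)) *
        (allForests R ^ (3 * j) * (1 + X * allForests R ^ 3) * centralBinomSeries R)) +
      X ^ ((k + 1) * m) * ((-1) ^ m * allForests R ^ (3 * m) * protectedVertexSeries R k) := by
  have hgeom := mul_neg_geom_sum (-(X ^ (k + 1) * allForests R ^ 3)) m
  have hsum : ∑ j ∈ range m, (-1) ^ j * (X ^ ((k + 1) * (j + 1)) *
        (allForests R ^ (3 * j) * (1 + X * allForests R ^ 3) * centralBinomSeries R)) =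
      X ^ (k + 1) * ((1 + X * allForests R ^ 3) * centralBinomSeries R) *
        ∑ j ∈ range m, (-(X ^ (k + 1) * allForests R ^ 3)) ^ j := by
    rw [mul_sum]
    refine sum_congr rfl fun j _ => ?_
    rw [neg_pow (X ^ (k + 1) * allForests R ^ 3)]
    ring
  rw [hsum, ← protectedVertexSeries_mul]
  rw [neg_pow] at hgeom
  linear_combination -protectedVertexSeries R k * hgeom

/-- The coefficient of `X ^ l` in `F ^ (3 * j) * (1 + X * F ^ 3) * B`, where `F` and `B` are the
generating functions of forests and of the central binomial coefficients. -/
def ballotSum (j : ℕ) : ℕ → ℕ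
  | 0 => 1
  | l + 1 => (l + 1 + (l + 1 + 3 * j)).choose (l + 1) + (l + (l + 3 * j + 3)).choose l

lemma coeff_allForests_pow_mul_eq_ballotSum (j l : ℕ) :
    coeff l (allForests R ^ (3 * j) * (1 + X * allForests R ^ 3) * centralBinomSeries R) =
      (ballotSum j l : R) := by
  have hcoeff := coeff_pow_mul_centralBinomSeries (allForests_eq R)
  have hsplit : allForests R ^ (3 * j) * (1 + X * allForests R ^ 3) * centralBinomSeries R =
      allForests R ^ (3 * j) * centralBinomSeries R +
        X * (allForests R ^ (3 * j + 3) * centralBinomSeries R) := by ring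
  rw [hsplit, map_add, hcoeff]
  cases l with
  | zero => simp [ballotSum]
  | succ l =>
    rw [coeff_succ_X_mul, hcoeff, ballotSum, Nat.cast_add]
    congr 3 <;> ring_nf

lemma coeff_protectedVertexSeries (n k : ℕ) :
    coeff n (protectedVertexSeries R k) =
      ∑ j ∈ range (n + 1), (-1) ^ j * if (k + 1) * (j + 1) ≤ n then
        (ballotSum j (n - (k + 1) * (j + 1)) : R) else 0 := by
  have hn : ¬(k + 1) * (n + 1) ≤ n := by nlinarith
  rw [protectedVertexSeries_eq_sum_add R k (n + 1), map_add, coeff_X_pow_mul', if_neg hn, add_zero,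
    map_sum]
  refine sum_congr rfl fun j _ => ?_
  have hsign : (-1 : R⟦X⟧) ^ j = C ((-1 : R) ^ j) := by simp
  rw [hsign, coeff_C_mul, coeff_X_pow_mul', coeff_allForests_pow_mul_eq_ballotSum]

end ProtectedSeries

end PlaneTree

section Probability

open scoped ENNReal

lemma toOuterMeasure_ofMultiset {α : Type*} (s : Multiset α) (hs : s ≠ 0) (A : Set α)
    [DecidablePred (· ∈ A)] :
    (PMF.ofMultiset s hs).toOuterMeasure A = s.countP (· ∈ A) / Multiset.card s := by
  classical
  rw [PMF.toOuterMeasure_ofMultiset_apply, Multiset.countP_eq_card_filter]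
  congr 1
  rw [← Multiset.toFinset_sum_count_eq, Nat.cast_sum,
    tsum_eq_sum (s := (s.filter (· ∈ A)).toFinset)]
  · congr!
  · intro a ha
    rw [Multiset.mem_toFinset] at ha
    simpa using Multiset.count_eq_zero_of_notMem ha

lemma toOuterMeasure_bind_uniformOfFinset {α β : Type*} (s : Finset α) (hs : s.Nonempty)
    (f : α → PMF β) (A : Set β) :
    ((PMF.uniformOfFinset s hs).bind f).toOuterMeasure A =
      (∑ a ∈ s, (f a).toOuterMeasure A) / s.card := by
  rw [PMF.toOuterMeasure_bind_apply, tsum_eq_sum (s := s), ENNReal.div_eq_inv_mul, Finset.mul_sum]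
  · refine Finset.sum_congr rfl fun a ha => ?_
    rw [PMF.uniformOfFinset_apply_of_mem hs ha]
  · intro a ha
    rw [PMF.uniformOfFinset_apply_of_notMem hs ha, zero_mul]

namespace PlaneTree

lemma toOuterMeasure_randomSubtree (t : PlaneTree) (k : ℕ) :
    (randomSubtree t).toOuterMeasure {x | k ≤ x.protection} =
      protectedCount k t / (t.size : ℝ≥0∞) := by
  rw [randomSubtree, toOuterMeasure_ofMultiset]
  simp [protectedCount, size]

open PowerSeries in
lemma toReal_vertexProtectionLaw (n : ℕ) (hn : 0 < n) (k : ℕ) :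
    ((vertexProtectionLaw n hn).toMeasure {m | k ≤ m}).toReal =
      coeff n (protectedVertexSeries ℝ k) / coeff n (protectedVertexSeries ℝ 0) := by
  have hcard : coeff n (protectedVertexSeries ℝ 0) = n * (treesOfSize n).card := by
    rw [protectedVertexSeries, treeSeries, coeff_mk, Finset.sum_congr rfl (g := fun _ => (n : ℝ))]
    · simp [mul_comm]
    · intro t ht
      rw [protectedCount_zero, mem_treesOfSize.1 ht]
  have hsum : ∑ t ∈ treesOfSize n, (randomSubtree t).toOuterMeasure {x | k ≤ x.protection} =
      (∑ t ∈ treesOfSize n, protectedCount k t : ℕ) / (n : ℝ≥0∞) := by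
    rw [Nat.cast_sum, ENNReal.div_eq_inv_mul, Finset.mul_sum]
    refine Finset.sum_congr rfl fun t ht => ?_
    rw [toOuterMeasure_randomSubtree, mem_treesOfSize.1 ht, ENNReal.div_eq_inv_mul]
  have hcount : coeff n (protectedVertexSeries ℝ k) =
      (∑ t ∈ treesOfSize n, protectedCount k t : ℕ) := by
    rw [protectedVertexSeries, treeSeries, coeff_mk, Nat.cast_sum]
  rw [PMF.toMeasure_apply_eq_toOuterMeasure_apply _ MeasurableSet.of_discrete,
    vertexProtectionLaw, PMF.toOuterMeasure_map_apply, randomTree,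
    toOuterMeasure_bind_uniformOfFinset, Set.preimage_ofPred_eq, hsum, hcard,
    hcount]
  simp [div_div, -Nat.cast_sum]

end PlaneTree

end Probability

section Asymptotics

open scoped Nat
open Real

lemma abs_log_sub_log_sub_le {x y : ℝ} (hy : 0 < y) (hxy : |x - y| ≤ y / 2) :
    |log x - log y - (x - y) / y| ≤ 2 * ((x - y) / y) ^ 2 := by
  set u : ℝ := -((x - y) / y) with hu
  have hu_half : |u| ≤ 1 / 2 := by
    rw [hu, abs_neg, abs_div, abs_of_pos hy, div_le_iff₀ hy]
    linarith
  have hx : x = y * (1 - u) := by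
    rw [hu]
    field_simp
    ring
  have hlog : log x - log y = log (1 - u) := by
    rw [hx, log_mul hy.ne' (by linarith [le_abs_self u]), add_sub_cancel_left]
  have h := abs_log_sub_add_sum_range_le (hu_half.trans_lt (by norm_num)) 1
  simp only [Finset.sum_range_one, zero_add, pow_one, Nat.cast_zero, div_one] at h
  rw [hlog, sub_eq_add_neg, ← hu, add_comm, ← neg_sq ((x - y) / y), ← hu]
  refine h.trans ?_
  rw [one_add_one_eq_two, sq_abs, div_le_iff₀ (by linarith)]
  nlinarith [sq_nonneg u]

/-- The error of the second-order expansion of `log M!` around `M = N`. -/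
noncomputable def logFactorialRemainder (N M : ℕ) : ℝ :=
  log M ! - log N ! - ((M - N) * log N + ((M - N) ^ 2 + (M - N)) / (2 * N))

lemma logFactorialRemainder_self (N : ℕ) : logFactorialRemainder N N = 0 := by
  simp [logFactorialRemainder]

lemma logFactorialRemainder_succ_sub {N : ℕ} (hN : 0 < N) (M : ℕ) :
    logFactorialRemainder N (M + 1) - logFactorialRemainder N M =
      log ((M + 1 : ℕ) : ℝ) - log N - (((M + 1 : ℕ) : ℝ) - N) / N := by
  have hfact : log ((M + 1)! : ℝ) = log ((M + 1 : ℕ) : ℝ) + log (M ! : ℝ) := by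
    rw [Nat.factorial_succ, Nat.cast_mul, log_mul (by positivity) (by positivity)]
  rw [logFactorialRemainder, logFactorialRemainder, hfact]
  push_cast
  field_simp
  ring

lemma dist_logFactorialRemainder_succ_le {N M : ℕ} {D : ℝ} (hN : 0 < N) (hDN : 2 * D ≤ N)
    (hM : |((M + 1 : ℕ) : ℝ) - N| ≤ D) :
    dist (logFactorialRemainder N M) (logFactorialRemainder N (M + 1)) ≤ 2 * (D / N) ^ 2 := by
  have hN' : (0 : ℝ) < N := by exact_mod_cast hN
  rw [dist_comm, dist_eq, logFactorialRemainder_succ_sub hN]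
  refine (abs_log_sub_log_sub_le hN' (hM.trans (by linarith))).trans ?_
  rw [div_pow, div_pow, ← sq_abs]
  gcongr

lemma dist_le_mul_of_dist_succ_le {α : Type*} [PseudoMetricSpace α] {f : ℕ → α} {m n : ℕ}
    {c : ℝ} (hmn : m ≤ n) (hf : ∀ i, m ≤ i → i < n → dist (f i) (f (i + 1)) ≤ c) :
    dist (f m) (f n) ≤ (n - m) * c := by
  have hsum := dist_le_Ico_sum_of_dist_le hmn (d := fun _ => c) fun {i} => hf i
  simpa [Nat.cast_sub hmn] using hsum

lemma abs_logFactorialRemainder_le {N M : ℕ} {D : ℝ} (hN : 0 < N) (hM : |(M : ℝ) - N| ≤ D)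
    (hDN : 2 * D ≤ N) : |logFactorialRemainder N M| ≤ 2 * D ^ 3 / N ^ 2 := by
  have hdist : |logFactorialRemainder N M| ≤ |(M : ℝ) - N| * (2 * (D / N) ^ 2) := by
    obtain ⟨hlower, hupper⟩ := abs_le.1 hM
    rw [← sub_zero (logFactorialRemainder N M), ← logFactorialRemainder_self N, ← dist_eq]
    rcases le_total N M with h | h
    · have hh : (N : ℝ) ≤ M := by exact_mod_cast h
      rw [dist_comm, abs_of_nonneg (by linarith)]
      refine dist_le_mul_of_dist_succ_le h fun i hNi hiM =>
        dist_logFactorialRemainder_succ_le hN hDN ?_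
      have h1 : (N : ℝ) ≤ i := by exact_mod_cast hNi
      have h2 : ((i + 1 : ℕ) : ℝ) ≤ M := by exact_mod_cast hiM
      rw [abs_le]
      push_cast at h2 ⊢
      constructor <;> linarith
    · have hh : (M : ℝ) ≤ N := by exact_mod_cast h
      rw [abs_sub_comm, abs_of_nonneg (by linarith)]
      refine dist_le_mul_of_dist_succ_le h fun i hMi hiN =>
        dist_logFactorialRemainder_succ_le hN hDN ?_
      have h1 : (M : ℝ) ≤ i := by exact_mod_cast hMi
      have h2 : ((i + 1 : ℕ) : ℝ) ≤ N := by exact_mod_cast hiN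
      rw [abs_le]
      push_cast at h2 ⊢
      constructor <;> linarith
  refine hdist.trans ?_
  calc |(M : ℝ) - N| * (2 * (D / N) ^ 2) ≤ D * (2 * (D / N) ^ 2) := by gcongr
    _ = 2 * D ^ 3 / N ^ 2 := by ring

lemma log_choose_add (a b : ℕ) :
    log ((a + b).choose a : ℝ) = log ((a + b)! : ℝ) - log (a ! : ℝ) - log (b ! : ℝ) := by
  have hpos : (0 : ℝ) < (a + b).choose b := by
    exact_mod_cast Nat.choose_pos (Nat.le_add_left b a)
  rw [Nat.choose_symm_add, ← Nat.add_choose_mul_factorial_mul_factorial a b, Nat.cast_mul,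
    Nat.cast_mul, log_mul (by positivity) (by positivity), log_mul (by positivity) (by positivity)]
  ring

/-- The ratio of the symmetric binomial probabilities of `a` successes in `a + b` trials and of
`N` successes in `2 * N` trials. -/
noncomputable def binomialRatio (N a b : ℕ) : ℝ :=
  ((a + b).choose a / 2 ^ (a + b)) / (N.centralBinom / 4 ^ N)

lemma binomialRatio_pos (N a b : ℕ) : 0 < binomialRatio N a b := by
  have ha : (0 : ℝ) < (a + b).choose a := by
    exact_mod_cast Nat.choose_pos (Nat.le_add_right a b)
  have hN : (0 : ℝ) < N.centralBinom := by exact_mod_cast N.centralBinom_pos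
  unfold binomialRatio
  positivity

lemma log_binomialRatio {N : ℕ} (hN : 0 < N) (a b : ℕ) :
    log (binomialRatio N a b) = (2 * N - a - b - (a - b) ^ 2) / 4 / N +
      (logFactorialRemainder (2 * N) (a + b) - logFactorialRemainder N a -
        logFactorialRemainder N b) := by
  have ha : (0 : ℝ) < (a + b).choose a := by
    exact_mod_cast Nat.choose_pos (Nat.le_add_right a b)
  have hB : (0 : ℝ) < (N + N).choose N := by exact_mod_cast Nat.choose_pos (Nat.le_add_right N N)
  have hfour : (4 : ℝ) ^ N = 2 ^ (2 * N) := by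
    rw [pow_mul]
    norm_num
  rw [binomialRatio, Nat.centralBinom_eq_two_mul_choose, hfour, two_mul N,
    log_div (by positivity) (by positivity), log_div (by positivity) (by positivity),
    log_div (by positivity) (by positivity), log_pow, log_pow, log_choose_add, log_choose_add]
  unfold logFactorialRemainder
  rw [← two_mul N, Nat.cast_mul, Nat.cast_ofNat, log_mul two_ne_zero (by positivity)]
  push_cast
  field_simp
  ring

lemma abs_log_binomialRatio_sub_le {N a b : ℕ} {D : ℝ} (hN : 0 < N) (ha : |(a : ℝ) - N| ≤ D)
    (hb : |(b : ℝ) - N| ≤ D) (hDN : 2 * D ≤ N) :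
    |log (binomialRatio N a b) - (2 * N - a - b - (a - b) ^ 2) / 4 / N| ≤
      8 * D ^ 3 / N ^ 2 := by
  have hab : |((a + b : ℕ) : ℝ) - (2 * N : ℕ)| ≤ 2 * D := by
    push_cast
    rw [abs_le] at *
    constructor <;> linarith
  have hsum := abs_logFactorialRemainder_le (by lia) hab (by push_cast; linarith)
  have hhalf : 2 * (2 * D) ^ 3 / ((2 * N : ℕ) : ℝ) ^ 2 = 4 * D ^ 3 / N ^ 2 := by
    push_cast
    field_simp
    ring
  rw [log_binomialRatio hN, add_sub_cancel_left]
  calc _ ≤ |logFactorialRemainder (2 * N) (a + b)| + |logFactorialRemainder N a| +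
        |logFactorialRemainder N b| :=
        (abs_sub _ _).trans (add_le_add_left (abs_sub _ _) _)
    _ ≤ 4 * D ^ 3 / N ^ 2 + 2 * D ^ 3 / N ^ 2 + 2 * D ^ 3 / N ^ 2 := by
        rw [← hhalf]
        gcongr
        · exact abs_logFactorialRemainder_le hN ha hDN
        · exact abs_logFactorialRemainder_le hN hb hDN
    _ = 8 * D ^ 3 / N ^ 2 := by ring

lemma abs_exp_sub_one_add_le {δ ε : ℝ} (hδ : |δ| ≤ 1) :
    |exp δ - (1 + ε)| ≤ δ ^ 2 + |δ - ε| :=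
  calc |exp δ - (1 + ε)| = |(exp δ - 1 - δ) + (δ - ε)| := by ring_nf
    _ ≤ |exp δ - 1 - δ| + |δ - ε| := abs_add_le _ _
    _ ≤ δ ^ 2 + |δ - ε| := by
        gcongr
        exact abs_exp_sub_one_sub_id_le hδ

lemma abs_sub_sub_sub_sq_div_four_le {x a b D : ℝ} (hD : 1 ≤ D) (ha : |a - x| ≤ D)
    (hb : |b - x| ≤ D) : |(2 * x - a - b - (a - b) ^ 2) / 4| ≤ 2 * D ^ 2 := by
  have hDD : D ≤ D ^ 2 := le_self_pow₀ hD two_ne_zero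
  rw [abs_le] at ha hb ⊢
  have hsq : (a - b) ^ 2 ≤ (2 * D) ^ 2 := by
    refine sq_le_sq' ?_ ?_ <;> linarith
  constructor <;> linarith [sq_nonneg (a - b)]

lemma abs_div_sub_div_add_one_le {x : ℝ} (hx : 0 < x) (c : ℝ) :
    |c / x - c / (x + 1)| ≤ |c| / x ^ 2 := by
  have hdiff : c / x - c / (x + 1) = c / (x * (x + 1)) := by
    field_simp
    ring
  rw [hdiff, abs_div, abs_of_pos (show 0 < x * (x + 1) by positivity)]
  gcongr
  nlinarith

lemma abs_log_binomialRatio_le {N a b : ℕ} {D : ℝ} (hD : 1 ≤ D) (ha : |(a : ℝ) - N| ≤ D)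
    (hb : |(b : ℝ) - N| ≤ D) (hDN : 16 * D ^ 2 ≤ N) :
    |log (binomialRatio N a b)| ≤ 3 * D ^ 2 / N := by
  have hN : (1 : ℝ) ≤ N := by nlinarith
  have hcubic : 8 * D ^ 3 / N ^ 2 ≤ D ^ 2 / N := by
    rw [div_le_div_iff₀ (by positivity) (by positivity)]
    have h8 : 8 * D ≤ N := by nlinarith
    calc 8 * D ^ 3 * N = D ^ 2 * N * (8 * D) := by ring
      _ ≤ D ^ 2 * N * N := by gcongr
      _ = D ^ 2 * N ^ 2 := by ring
  have hlog := abs_log_binomialRatio_sub_le (by exact_mod_cast hN) ha hb (by nlinarith)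
  have hlin := abs_sub_sub_sub_sq_div_four_le hD ha hb
  set γ : ℝ := (2 * N - a - b - (a - b) ^ 2) / 4
  calc |log (binomialRatio N a b)| = |(log (binomialRatio N a b) - γ / N) + γ / N| := by ring_nf
    _ ≤ |log (binomialRatio N a b) - γ / N| + |γ / N| := abs_add_le _ _
    _ ≤ D ^ 2 / N + 2 * D ^ 2 / N := by
        rw [abs_div γ, Nat.abs_cast]
        gcongr
        exact hlog.trans hcubic
    _ = 3 * D ^ 2 / N := by ring

lemma abs_binomialRatio_sub_le {N a b : ℕ} {D : ℝ} (hD : 1 ≤ D) (ha : |(a : ℝ) - N| ≤ D)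
    (hb : |(b : ℝ) - N| ≤ D) (hDN : 16 * D ^ 2 ≤ N) :
    |binomialRatio N a b - (1 + (2 * N - a - b - (a - b) ^ 2) / 4 / (N + 1))| ≤
      76 * D ^ 4 / (N + 1) ^ 2 := by
  have hN : (1 : ℝ) ≤ N := by nlinarith
  have hlog := abs_log_binomialRatio_le hD ha hb hDN
  have hlog_sub := abs_log_binomialRatio_sub_le (by exact_mod_cast hN) ha hb (by nlinarith)
  have hlin := abs_sub_sub_sub_sq_div_four_le hD ha hb
  set γ : ℝ := (2 * N - a - b - (a - b) ^ 2) / 4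
  have hexp := abs_exp_sub_one_add_le (ε := γ / N)
    (hlog.trans ((div_le_one (by positivity)).2 (by nlinarith)))
  rw [exp_log (binomialRatio_pos N a b), ← sq_abs] at hexp
  have hshift := abs_div_sub_div_add_one_le (show (0 : ℝ) < N by linarith) γ
  calc _ = |(binomialRatio N a b - (1 + γ / N)) + (γ / N - γ / (N + 1))| := by ring_nf
    _ ≤ |log (binomialRatio N a b)| ^ 2 + |log (binomialRatio N a b) - γ / N| + |γ| / N ^ 2 :=
        (abs_add_le _ _).trans (add_le_add hexp hshift)
    _ ≤ (3 * D ^ 2 / N) ^ 2 + 8 * D ^ 3 / N ^ 2 + 2 * D ^ 2 / N ^ 2 := by gcongr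
    _ = (9 * D ^ 4 + 8 * D ^ 3 + 2 * D ^ 2) / N ^ 2 := by ring
    _ ≤ (9 * D ^ 4 + 8 * D ^ 4 + 2 * D ^ 4) / ((N + 1) / 2) ^ 2 := by
        gcongr
        · norm_num
        · norm_num
        · linarith
    _ = 76 * D ^ 4 / (N + 1) ^ 2 := by
        field_simp
        ring

end Asymptotics

namespace PlaneTree

section Terms

/-- The contribution of the index `j` in `coeff_protectedVertexSeries`, for `s = k * (j + 1)` and
trees with `N + 1` vertices, rescaled by `4 ^ s / 2 ^ j` so as to be of order one. -/
noncomputable def normalizedTerm (N s j : ℕ) : ℝ :=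
  if s + j ≤ N then 4 ^ s / 2 ^ j * ballotSum j (N - (s + j)) / N.centralBinom else 0

/-- The first-order expansion in `1 / n` of `normalizedTerm (n - 1) s j`. -/
noncomputable def termExpansion (s j : ℕ) (n : ℝ) : ℝ :=
  3 + (6 * s - 27 * j ^ 2 - 39 * j - 20) / 4 / n

lemma four_pow_eq_two_pow_mul_two_pow (m : ℕ) : (4 : ℝ) ^ m = 2 ^ m * 2 ^ m := by
  rw [← mul_pow]
  norm_num

lemma normalizedTerm_eq_binomialRatio {N s j l : ℕ} (hN : N = l + 1 + (s + j)) :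
    normalizedTerm N s j =
      binomialRatio N (l + 1) (l + 1 + 3 * j) + 2 * binomialRatio N l (l + 3 * j + 3) := by
  rw [normalizedTerm, if_pos (by lia), show N - (s + j) = l + 1 by lia, ballotSum, binomialRatio,
    binomialRatio, hN, four_pow_eq_two_pow_mul_two_pow, four_pow_eq_two_pow_mul_two_pow]
  push_cast
  field_simp
  ring

lemma ballotSum_le (j l : ℕ) : ballotSum j l ≤ 3 * 2 ^ (2 * l + 3 * j) := by
  cases l with
  | zero => linarith [Nat.one_le_two_pow (n := 2 * 0 + 3 * j), ballotSum.eq_1 j]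
  | succ l =>
    calc ballotSum j (l + 1) ≤ 2 ^ (l + 1 + (l + 1 + 3 * j)) + 2 ^ (l + (l + 3 * j + 3)) :=
          add_le_add (Nat.choose_le_two_pow _ _) (Nat.choose_le_two_pow _ _)
      _ = 3 * 2 ^ (2 * (l + 1) + 3 * j) := by ring

lemma normalizedTerm_nonneg (N s j : ℕ) : 0 ≤ normalizedTerm N s j := by
  unfold normalizedTerm
  positivity

lemma normalizedTerm_le (N s j : ℕ) : normalizedTerm N s j ≤ 6 * (N + 1) := by
  unfold normalizedTerm
  split_ifs with h
  · obtain ⟨l, rfl⟩ := Nat.exists_eq_add_of_le h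
    set N := s + j + l
    have hcentral : (4 : ℝ) ^ N ≤ (2 * N + 1) * N.centralBinom := by
      rw [Nat.centralBinom_eq_two_mul_choose]
      exact_mod_cast Nat.four_pow_le_two_mul_add_one_mul_central_binom N
    rw [Nat.add_sub_cancel_left, div_le_iff₀ (by exact_mod_cast N.centralBinom_pos)]
    calc (4 : ℝ) ^ s / 2 ^ j * ballotSum j l ≤ 4 ^ s / 2 ^ j * (3 * 2 ^ (2 * l + 3 * j)) := by
          gcongr
          exact_mod_cast ballotSum_le j l
      _ = 3 * 4 ^ N := by
          rw [four_pow_eq_two_pow_mul_two_pow, four_pow_eq_two_pow_mul_two_pow]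
          field_simp
          ring
      _ ≤ 3 * ((2 * N + 1) * N.centralBinom) := by gcongr
      _ ≤ 6 * (N + 1) * N.centralBinom := by nlinarith
  · positivity

lemma abs_normalizedTerm_sub_le_of_le {N s j : ℕ} (hs : j + 1 ≤ s) (hN : 64 * s ^ 2 ≤ N) :
    |normalizedTerm N s j - termExpansion s j (N + 1)| ≤ 3648 * s ^ 4 / (N + 1) ^ 2 := by
  obtain ⟨l, hl⟩ := Nat.exists_eq_add_of_le' (show 1 + (s + j) ≤ N by nlinarith)
  rw [← add_assoc] at hl
  have hNl : (N : ℝ) = l + 1 + (s + j) := by exact_mod_cast hl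
  have hj : (j : ℝ) + 1 ≤ s := by exact_mod_cast hs
  have : (0 : ℝ) ≤ j := j.cast_nonneg
  have hD : 1 ≤ 2 * (s : ℝ) := by linarith
  have hDN : 16 * (2 * (s : ℝ)) ^ 2 ≤ N := by
    have : 64 * (s : ℝ) ^ 2 ≤ N := by exact_mod_cast hN
    linarith
  have hfirst := abs_binomialRatio_sub_le (N := N) (a := l + 1) (b := l + 1 + 3 * j) hD
    (by rw [abs_le]; push_cast; constructor <;> linarith)
    (by rw [abs_le]; push_cast; constructor <;> linarith) hDN
  have hsecond := abs_binomialRatio_sub_le (N := N) (a := l) (b := l + 3 * j + 3) hD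
    (by rw [abs_le]; constructor <;> linarith)
    (by rw [abs_le]; push_cast; constructor <;> linarith) hDN
  have hexpansion : termExpansion s j (N + 1) =
      1 + (2 * N - (l + 1 : ℕ) - (l + 1 + 3 * j : ℕ) -
        ((l + 1 : ℕ) - (l + 1 + 3 * j : ℕ)) ^ 2) / 4 / (N + 1) +
      2 * (1 + (2 * N - l - (l + 3 * j + 3 : ℕ) -
        (l - (l + 3 * j + 3 : ℕ)) ^ 2) / 4 / (N + 1)) := by
    rw [termExpansion]
    push_cast
    linear_combination (-3 / 2 / (N + 1)) * hNl
  have hbound : 3648 * (s : ℝ) ^ 4 / (N + 1) ^ 2 = 3 * (76 * (2 * s) ^ 4 / (N + 1) ^ 2) := by ring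
  rw [normalizedTerm_eq_binomialRatio hl, hexpansion, hbound]
  rw [abs_le] at hfirst hsecond ⊢
  constructor <;> linarith

lemma abs_termExpansion_le {s j : ℕ} (hs : j + 1 ≤ s) {n : ℝ} (hn : 1 ≤ n) :
    |termExpansion s j n| ≤ 26 * s ^ 2 := by
  have hj : (j : ℝ) + 1 ≤ s := by exact_mod_cast hs
  have : (0 : ℝ) ≤ j := j.cast_nonneg
  have hnum : |6 * (s : ℝ) - 27 * j ^ 2 - 39 * j - 20| ≤ 92 * (s : ℝ) ^ 2 := by
    rw [abs_le]
    constructor <;> nlinarith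
  calc |termExpansion s j n|
      ≤ |3| + |(6 * (s : ℝ) - 27 * j ^ 2 - 39 * j - 20) / 4 / n| := abs_add_le _ _
    _ ≤ 3 + 23 * s ^ 2 := by
        gcongr
        · norm_num
        · rw [abs_div, abs_div, abs_of_pos (show 0 < n by linarith)]
          refine (div_le_self (by positivity) hn).trans ?_
          rw [abs_of_pos (show (0 : ℝ) < 4 by norm_num)]
          linarith
    _ ≤ 26 * s ^ 2 := by nlinarith

lemma abs_normalizedTerm_sub_le {N s j : ℕ} (hs : j + 1 ≤ s) :
    |normalizedTerm N s j - termExpansion s j (N + 1)| ≤ 2000000 * s ^ 6 / (N + 1) ^ 2 := by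
  have hs1 : (1 : ℝ) ≤ s := by exact_mod_cast (Nat.le_add_left 1 j).trans hs
  rcases le_or_gt (64 * s ^ 2) N with hN | hN
  · refine (abs_normalizedTerm_sub_le_of_le hs hN).trans ?_
    gcongr <;> norm_num
  · have hN' : (N : ℝ) + 1 ≤ 64 * s ^ 2 := by exact_mod_cast hN
    calc |normalizedTerm N s j - termExpansion s j (N + 1)|
        ≤ |normalizedTerm N s j| + |termExpansion s j (N + 1)| := abs_sub _ _
      _ ≤ 6 * (N + 1) + 26 * s ^ 2 := by
          rw [abs_of_nonneg (normalizedTerm_nonneg N s j)]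
          gcongr
          · exact normalizedTerm_le N s j
          · exact abs_termExpansion_le hs (by simp)
      _ ≤ 410 * s ^ 2 := by linarith
      _ ≤ 2000000 * s ^ 6 / (N + 1) ^ 2 := by
          rw [le_div_iff₀ (by positivity)]
          calc 410 * (s : ℝ) ^ 2 * (N + 1) ^ 2 ≤ 410 * s ^ 2 * (64 * (s : ℝ) ^ 2) ^ 2 := by gcongr
            _ = 1679360 * (s : ℝ) ^ 6 := by ring
            _ ≤ 2000000 * (s : ℝ) ^ 6 := by gcongr; norm_num

end Terms

section Tail

lemma hasSum_toReal_vertexProtectionLaw {N : ℕ} (hn : 0 < N + 1) (k : ℕ) :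
    HasSum (fun j => (4 ^ k)⁻¹ * (-(2 / 4 ^ k)) ^ j * normalizedTerm N (k * (j + 1)) j)
      ((vertexProtectionLaw (N + 1) hn).toMeasure {m | k ≤ m}).toReal := by
  have hterm (j : ℕ) : (4 ^ k)⁻¹ * (-(2 / 4 ^ k)) ^ j * normalizedTerm N (k * (j + 1)) j =
      (-1) ^ j * (if (k + 1) * (j + 1) ≤ N + 1 then
        (ballotSum j (N + 1 - (k + 1) * (j + 1)) : ℝ) else 0) / N.centralBinom := by
    have hindex : (k + 1) * (j + 1) = k * (j + 1) + j + 1 := by ring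
    simp only [normalizedTerm, hindex, Nat.add_le_add_iff_right, Nat.add_sub_add_right]
    split_ifs
    · rw [neg_pow, div_pow, pow_mul, pow_succ, four_pow_eq_two_pow_mul_two_pow]
      field_simp
    · simp
  simp only [hterm]
  rw [toReal_vertexProtectionLaw, coeff_protectedVertexSeries,
    coeff_succ_protectedVertexSeries_zero, Finset.sum_div]
  refine hasSum_sum_of_ne_finset_zero fun j hj => ?_
  rw [Finset.mem_range, not_lt] at hj
  rw [if_neg (by nlinarith), mul_zero, zero_div]

lemma hasSum_pow_mul_termExpansion {y : ℝ} (hy : |y| < 1) (k : ℕ) (n : ℝ) :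
    HasSum (fun j => y ^ j * termExpansion (k * (j + 1)) j n)
      ((3 - 2 / n) / (1 - y) + (6 * k + 42) / 4 / n / (1 - y) ^ 2 - 27 / 2 / n / (1 - y) ^ 3) := by
  have h0 := (hasSum_choose_mul_geometric_of_norm_lt_one 0 hy).mul_left (3 - 2 / n)
  have h1 := (hasSum_choose_mul_geometric_of_norm_lt_one 1 hy).mul_left ((6 * k + 42) / 4 / n)
  have h2 := (hasSum_choose_mul_geometric_of_norm_lt_one 2 hy).mul_left (27 / 2 / n)
  have h := (h0.add h1).sub h2
  simp only [zero_add, pow_one, Nat.reduceAdd, mul_one_div] at h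
  refine h.congr_fun fun j => ?_
  rw [Nat.cast_choose_two, Nat.choose_zero_right, Nat.choose_one_right, termExpansion]
  push_cast
  ring

lemma two_div_four_pow_le_half {k : ℕ} (hk : k ≠ 0) : 2 / (4 : ℝ) ^ k ≤ 1 / 2 := by
  rw [div_le_div_iff₀ (by positivity) two_pos]
  linarith [le_self_pow₀ (show (1 : ℝ) ≤ 4 by norm_num) hk]

lemma hasSum_termExpansion {k : ℕ} (hk : k ≠ 0) {n : ℝ} (hn : n ≠ 0) :
    HasSum (fun j => (4 ^ k)⁻¹ * (-(2 / 4 ^ k)) ^ j * termExpansion (k * (j + 1)) j n)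
      (3 / (4 ^ k + 2) + ((3 * k - 10) * 4 ^ (2 * k) + (6 * k + 26) * 4 ^ k - 16) /
        (2 * (4 ^ k + 2) ^ 3) * (1 / n)) := by
  have hy : |(-(2 / 4 ^ k) : ℝ)| < 1 := by
    rw [abs_neg, abs_of_pos (by positivity)]
    linarith [two_div_four_pow_le_half hk]
  have hsub : (1 : ℝ) - -(2 / 4 ^ k) = (4 ^ k + 2) / 4 ^ k := by
    field_simp
    ring
  have hvalue : 3 / (4 ^ k + 2) + ((3 * k - 10) * 4 ^ (2 * k) + (6 * k + 26) * 4 ^ k - 16) /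
        (2 * (4 ^ k + 2) ^ 3) * (1 / n) =
      (4 ^ k)⁻¹ * ((3 - 2 / n) / (1 - -(2 / 4 ^ k)) + (6 * k + 42) / 4 / n / (1 - -(2 / 4 ^ k)) ^ 2
        - 27 / 2 / n / (1 - -(2 / 4 ^ k)) ^ 3) := by
    rw [hsub, mul_comm 2 k, pow_mul]
    field_simp
    ring
  rw [hvalue]
  simpa only [mul_assoc] using (hasSum_pow_mul_termExpansion hy k n).mul_left (4 ^ k)⁻¹

lemma summable_succ_pow_six_mul_half_pow :
    Summable fun j : ℕ => ((j : ℝ) + 1) ^ 6 * (1 / 2) ^ j := by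
  have h := (summable_nat_add_iff (f := fun j : ℕ => (j : ℝ) ^ 6 * (1 / 2) ^ j) 1).2
    (summable_pow_mul_geometric_of_norm_lt_one 6 (show ‖(1 / 2 : ℝ)‖ < 1 by norm_num))
  refine (h.mul_left 2).congr fun j => ?_
  push_cast
  ring

lemma abs_toReal_vertexProtectionLaw_sub_le {N : ℕ} (hn : 0 < N + 1) {k : ℕ} (hk : k ≠ 0) :
    |((vertexProtectionLaw (N + 1) hn).toMeasure {m | k ≤ m}).toReal
        - (3 / ((4 : ℝ) ^ k + 2) + ((3 * (k : ℝ) - 10) * 4 ^ (2 * k) + (6 * k + 26) * 4 ^ k - 16)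
            / (2 * (4 ^ k + 2) ^ 3) * (1 / (N + 1)))|
      ≤ (2000000 * ∑' j : ℕ, ((j : ℝ) + 1) ^ 6 * (1 / 2) ^ j)
          * ((k : ℝ) ^ 6 / (4 ^ k * (N + 1) ^ 2)) := by
  have hdiff := (hasSum_toReal_vertexProtectionLaw hn k).sub
    (hasSum_termExpansion hk (show (N : ℝ) + 1 ≠ 0 by positivity))
  have hbound := summable_succ_pow_six_mul_half_pow.hasSum.mul_left
    (2000000 * (k ^ 6 / (4 ^ k * ((N : ℝ) + 1) ^ 2)))
  rw [mul_right_comm, ← Real.norm_eq_abs]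
  refine hdiff.norm_le_of_bounded hbound fun j => ?_
  have hweight : |((4 : ℝ) ^ k)⁻¹ * (-(2 / 4 ^ k)) ^ j| ≤ (4 ^ k)⁻¹ * (1 / 2) ^ j := by
    rw [abs_mul, abs_pow, abs_neg, abs_of_pos (by positivity), abs_of_pos (by positivity)]
    gcongr ?_ * ?_ ^ j
    exact two_div_four_pow_le_half hk
  rw [← mul_sub, Real.norm_eq_abs, abs_mul]
  calc _ ≤ (4 ^ k)⁻¹ * (1 / 2) ^ j * (2000000 * ((k * (j + 1) : ℕ) : ℝ) ^ 6 / (N + 1) ^ 2) := by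
        gcongr
        exact abs_normalizedTerm_sub_le (Nat.le_mul_of_pos_left _ (Nat.pos_of_ne_zero hk))
    _ = _ := by
        push_cast
        field_simp

end Tail

end PlaneTree

lemma exists_pow_six_div_four_pow_le :
    ∃ B : ℝ, ∀ k : ℕ, (k : ℝ) ^ 6 / 4 ^ k ≤ B * (k ^ 2 / 3 ^ k) := by
  obtain ⟨B, hB⟩ := (tendsto_pow_const_mul_const_pow_of_abs_lt_one 4
    (show |(3 / 4 : ℝ)| < 1 by norm_num [abs_lt])).bddAbove_range
  refine ⟨B, fun k => ?_⟩
  calc (k : ℝ) ^ 6 / 4 ^ k = k ^ 4 * (3 / 4) ^ k * (k ^ 2 / 3 ^ k) := by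
        rw [div_pow]
        field_simp
    _ ≤ B * (k ^ 2 / 3 ^ k) := by
        gcongr
        exact hB ⟨k, rfl⟩

theorem mainTheorem4 :
    ∃ C : ℝ, ∀ (n : ℕ) (hn : 0 < n) (k : ℕ),
      |((PlaneTree.vertexProtectionLaw n hn).toMeasure {m : ℕ | k ≤ m}).toReal
          - (3 / ((4 : ℝ) ^ k + 2)
            + ((3 * (k : ℝ) - 10) * (4 : ℝ) ^ (2 * k) + (6 * (k : ℝ) + 26) * (4 : ℝ) ^ k - 16)
                / (2 * ((4 : ℝ) ^ k + 2) ^ 3) * (1 / (n : ℝ)))|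
        ≤ C * ((k : ℝ) ^ 2 / ((3 : ℝ) ^ k * (n : ℝ) ^ 2)) := by
  obtain ⟨B, hB⟩ := exists_pow_six_div_four_pow_le
  refine ⟨(2000000 * ∑' j : ℕ, ((j : ℝ) + 1) ^ 6 * (1 / 2) ^ j) * B, fun n hn k => ?_⟩
  obtain ⟨N, rfl⟩ := Nat.exists_eq_add_of_le' hn
  rcases eq_or_ne k 0 with rfl | hk
  · simp only [Nat.zero_le, Set.ofPred_true, MeasureTheory.measure_univ]
    norm_num
  · rw [Nat.cast_succ]
    refine (PlaneTree.abs_toReal_vertexProtectionLaw_sub_le hn hk).trans ?_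
    rw [← div_div, ← div_div, mul_assoc _ B, ← mul_div_assoc B]
    gcongr
    exact hB k
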